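/- **Theorem 1 (agreement).** Consider $n$ processes $p_1,\dots,p_n$, at most $t$ of which are Byzantine, with $n>3t$; the others are correct. Every pair of processes is joined by links in both directions that do not create, alter or duplicate messages; transfer delays and relative speeds are arbitrary. Messages are signed. A Byzantine process may send anything to anybody at any time, except that signatures of correct processes cannot be forged: every signed message of a correct process that occurs in a message, at any depth, was signed and sent by that process before. Let $V$ be an arbitrary set of values and $\bot\notin V$; process $p_i$ proposes $v_i\in V$. Each correct process $p_i$ runs the following protocol. *Init phase.* Send INIT$(v_i)$ to all and wait for INIT messages from at least $n-t$ distinct processes; if some $v$ has been received at least $n-2t$ times, set $est_i:=v$ for such a $v$, otherwise $est_i:=v_i$. Then execute rounds $r=1,2,\dots$; the coordinator of round $r$ is $p_c$ with $c=((r-1)\bmod n)+1$. *Phase 1.* Send QUERY$(r,est_i)$ to all and set a timer to $\Delta_i[c]$ (initially $1$). Wait until RESPONSE$(r,\cdot)$ has been received from $p_c$, or the timer has expired and RESPONSE$(r,\cdot)$ has been received from at least $n-t$ distinct processes. If $p_c$ has responded with $est$, set $aux_i:=est$, otherwise $aux_i:=\bot$. If the timer has expired, increment $\Delta_i[c]$,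 otherwise disable the timer. *Phase 2.* Send RELAY$(r,aux_i)$ to all, wait for RELAY$(r,\cdot)$ from at least $n-t$ distinct processes, and let $V_i$ be the set of values received. If $V_i\setminus\{\bot\}=\{v\}$, set $aux_i:=v$, otherwise $aux_i:=\bot$. *Phase 3.* Send FILT1$(r,aux_i)$ to all, wait for FILT1$(r,\cdot)$ from at least $n-t$ distinct processes, and let $V_i$ be the set of values received. If $V_i=\{v\}$, set $aux_i:=v$, otherwise $aux_i:=\bot$. *Phase 4.* Send FILT2$(r,aux_i)$ to all, wait for FILT2$(r,\cdot)$ from at least $n-t$ distinct processes, and let $V_i$ be the set of values received. If $V_i=\{v\}$ with $v\ne\bot$, send DEC$(v)$ to all, decide $v$ and stop. If $V_i=\{v,\bot\}$ with $v\neq\bot$, set $est_i:=v$. Otherwise keep $est_i$. Go to the next round. *Concurrently.* On receipt of QUERY$(r,est)$ from $p_j$, send RESPONSE$(r,x)$ to $p_j$, where $x$ is the value of the first QUERY of round $r$ that was received if $p_i$ is the coordinator of round $r$, and $x=\bot$ otherwise. On receipt of DEC$(v)$, send DEC$(v)$ to all, decide $v$ and stop. *Certificates.* Every message other than INIT carries,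 as a certificate, the signed messages (with their own certificates) from which its value was computed. This is: the INIT messages received (and the sender's own INIT if it keeps its own proposal) for a QUERY of round $1$; the FILT2 messages of round $r$ (and, if they are all $\bot$, the sender's QUERY of round $r$ with the same value) for a QUERY of round $r+1$; the QUERY message for the RESPONSE of the coordinator; the coordinator's RESPONSE for a RELAY with a value $\ne\bot$, and at least $n-t$ RESPONSE messages of distinct processes other than the coordinator for RELAY$(r,\bot)$; the RELAY messages for FILT1; the FILT1 messages for FILT2; the FILT2 messages (all with value $v$, and from at least $n-t$ distinct processes) for DEC$(v)$, whoever sends it. The RESPONSE of a process that is not the coordinator needs no certificate, and its value is not checked. A message is *valid* if all messages of its certificate are valid and its value is the one that the protocol computes from them. A correct process discards every received message that is not valid, that is not signed by the process at the other end of the link, or that is a second message of the same kind and round from the same sender. Then, in every run, no two correct processes decide different values, whether they decide in the fourth phase of a round or on receipt of a DEC message. -/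

import Mathlib

universe u

namespace AuthByzConsensus

/-! ## Signed messages and certificates

`n` is the number of processes, identified with `Fin n`; `t` bounds the number of Byzantine ones.
`V` is the (arbitrary) set of proposable values; `Option V` adds the default value `⊥ = none`,
which cannot be proposed. -/

/-- The kind of a message, together with its round number where it has one. -/
inductive Tag : Type
  | init
  | query (r : ℕ)
  | response (r : ℕ)
  | relay (r : ℕ)
  | filt1 (r : ℕ)
  | filt2 (r : ℕ)
  | dec
  deriving DecidableEq

/-- A message signed by `sender`.  It carries a value and a certificate, that is, a collection of
signed messages (each with its own certificate).  The signature covers the whole message. -/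
structure Msg (n : ℕ) (V : Type u) : Type u where
  sender : Fin n
  tag : Tag
  val : Option V
  cert : List (Msg n V)

variable {n : ℕ} {V : Type u}

/-- `Sub x m`: the signed message `x` is `m` itself or occurs, at any depth, in its certificate. -/
inductive Sub : Msg n V → Msg n V → Prop
  | refl (m : Msg n V) : Sub m m
  | cert (x m' m : Msg n V) : m' ∈ m.cert → Sub x m' → Sub x m

/-- `p` is the coordinator of round `r`.  Rounds are numbered from `1`, processes from `0`, and the
coordinators rotate. -/
def IsCoord (r : ℕ) (p : Fin n) : Prop := (p : ℕ) = (r - 1) % n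

/-- The set of values carried by a collection of messages. -/
def vals (F : List (Msg n V)) : Set (Option V) := {x | ∃ m ∈ F, m.val = x}

open Classical in
/-- The number of messages of a collection that carry the value `v`. -/
noncomputable def countVal (v : V) (F : List (Msg n V)) : ℕ :=
  F.countP (fun m => decide (m.val = some v))

/-- Messages of the same kind and round from at least `n - t` distinct processes. -/
def IsQuorum (t : ℕ) (g : Tag) (F : List (Msg n V)) : Prop :=
  (∀ m ∈ F, m.tag = g) ∧ (F.map Msg.sender).Nodup ∧ n - t ≤ F.length

/-- End of the second phase: `a = v` if `v` is the only non-`⊥` value in `S`, and otherwise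
`a = ⊥`. -/
def RelayRule (S : Set (Option V)) (a : Option V) : Prop :=
  ∀ v : V, a = some v ↔ S \ {none} = {some v}

/-- End of the third phase: `a = v` if `v` is the only value in `S`, and otherwise `a = ⊥`. -/
def FiltRule (S : Set (Option V)) (a : Option V) : Prop :=
  ∀ v : V, a = some v ↔ S = {some v}

/-- The check made by the filtering daemon of a receiver: the certificate consists of valid
messages, and the value of the message is the one that the code of the protocol makes a process
send when it has received the messages in the certificate.

An estimate that is kept because only `⊥` was received in the fourth phase of a round is certified
by those `⊥` messages together with the QUERY message by which the sender had justified that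
estimate in that round.  A DEC message is certified by the messages of the fourth phase that led to
the decision, whoever sends it.  The value in a RESPONSE message of a process that is not the
coordinator is meaningless, and therefore not checked. -/
inductive Valid (t : ℕ) : Msg n V → Prop
  | init (p : Fin n) (v : V) : Valid t ⟨p, .init, some v, []⟩
  | queryFrequent (p : Fin n) (v : V) (F : List (Msg n V)) :
      IsQuorum t .init F → (∀ m ∈ F, Valid t m) → n - 2 * t ≤ countVal v F →
      Valid t ⟨p, .query 1, some v, F⟩
  | queryOwn (p : Fin n) (v : V) (F : List (Msg n V)) :
      IsQuorum t .init F → (∀ m ∈ F, Valid t m) → (∀ w : V, countVal w F < n - 2 * t) →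
      Valid t ⟨p, .query 1, some v, ⟨p, .init, some v, []⟩ :: F⟩
  | queryAdopt (p : Fin n) (r : ℕ) (v : V) (F : List (Msg n V)) :
      IsQuorum t (.filt2 r) F → (∀ m ∈ F, Valid t m) → vals F = {some v, none} →
      Valid t ⟨p, .query (r + 1), some v, F⟩
  | queryKeep (p : Fin n) (r : ℕ) (v : V) (C F : List (Msg n V)) :
      IsQuorum t (.filt2 r) F → (∀ m ∈ F, Valid t m) → vals F = {none} →
      Valid t ⟨p, .query r, some v, C⟩ →
      Valid t ⟨p, .query (r + 1), some v, ⟨p, .query r, some v, C⟩ :: F⟩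
  | responseCoord (p : Fin n) (r : ℕ) (v : V) (m : Msg n V) :
      IsCoord r p → m.tag = .query r → m.val = some v → Valid t m →
      Valid t ⟨p, .response r, some v, [m]⟩
  | responseOther (p : Fin n) (r : ℕ) (x : Option V) :
      1 ≤ r → ¬ IsCoord r p → Valid t ⟨p, .response r, x, []⟩
  | relayValue (p : Fin n) (r : ℕ) (v : V) (m : Msg n V) :
      m.tag = .response r → IsCoord r m.sender → m.val = some v → Valid t m →
      Valid t ⟨p, .relay r, some v, [m]⟩
  | relayBot (p : Fin n) (r : ℕ) (F : List (Msg n V)) :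
      IsQuorum t (.response r) F → (∀ m ∈ F, Valid t m) → (∀ m ∈ F, ¬ IsCoord r m.sender) →
      Valid t ⟨p, .relay r, none, F⟩
  | filt1 (p : Fin n) (r : ℕ) (a : Option V) (F : List (Msg n V)) :
      IsQuorum t (.relay r) F → (∀ m ∈ F, Valid t m) → RelayRule (vals F) a →
      Valid t ⟨p, .filt1 r, a, F⟩
  | filt2 (p : Fin n) (r : ℕ) (a : Option V) (F : List (Msg n V)) :
      IsQuorum t (.filt1 r) F → (∀ m ∈ F, Valid t m) → FiltRule (vals F) a →
      Valid t ⟨p, .filt2 r, a, F⟩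
  | dec (p : Fin n) (r : ℕ) (v : V) (F : List (Msg n V)) :
      IsQuorum t (.filt2 r) F → (∀ m ∈ F, Valid t m) → vals F = {some v} →
      Valid t ⟨p, .dec, some v, F⟩

/-! ## The code of a correct process -/

/-- Control points of the main task. -/
inductive PC : Type
  | start
  | waitInit
  | newRound
  | waitResponse
  | waitRelay
  | waitFilt1
  | waitFilt2
  | done

/-- Local state of a process. -/
structure LocalState (n : ℕ) (V : Type u) : Type u where
  /-- control point of the main task; `done` once the process has returned -/
  pc : PC
  /-- current round number -/
  rd : ℕ
  /-- current estimate -/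
  est : V
  /-- certificate of the current estimate -/
  estCert : List (Msg n V)
  /-- the auxiliary variable of the current round -/
  aux : Option V
  /-- the current time-out values, one for each process -/
  delta : Fin n → ℕ
  /-- `none`: disabled; `some k`: set, expires in `k` ticks of the local clock;
  `some 0`: timed out -/
  timer : Option ℕ
  /-- messages that were received and that passed the daemon -/
  rcvd : List (Msg n V)
  /-- the coordination value of the coordination task of each round -/
  cEst : ℕ → Option V
  /-- the certificate of that coordination value -/
  cCert : ℕ → List (Msg n V)
  /-- the value returned by the process, if it has returned -/
  decided : Option V

/-- Initial local state of a process that proposes `x`. -/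
def LocalState.initial (x : V) : LocalState n V where
  pc := .start
  rd := 0
  est := x
  estCert := []
  aux := none
  delta := fun _ => 1
  timer := none
  rcvd := []
  cEst := fun _ => none
  cCert := fun _ => []
  decided := none

/-- The accepted messages of a given kind and round. -/
def LocalState.received (s : LocalState n V) (g : Tag) : List (Msg n V) :=
  s.rcvd.filter (fun m => decide (m.tag = g))

/-- The time-out values after the first phase of a round with coordinator `c`. -/
def LocalState.nextDelta (s : LocalState n V) (c : Fin n) : Fin n → ℕ :=
  if s.timer = some 0 then Function.update s.delta c (s.delta c + 1) else s.delta

/-- Messages handed to the network by one process in one step: pairs (destination, message). -/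
abbrev Out (n : ℕ) (V : Type u) : Type u := Multiset (Fin n × Msg n V)

/-- Send `m` to all processes, including the sender. -/
def toAll (m : Msg n V) : Out n V := (Finset.univ : Finset (Fin n)).val.map (fun q => (q, m))

/-- The steps of the main task of process `p` with proposal `x`: from a local state, to a local
state, and the messages sent.  A wait statement ends at an arbitrary moment at which its condition
holds. -/
inductive MainStep (t : ℕ) (p : Fin n) (x : V) : LocalState n V → LocalState n V → Out n V → Prop
  /-- broadcast the proposal -/
  | sendInit (s : LocalState n V) : s.pc = .start →
      MainStep t p x s { s with pc := .waitInit } (toAll ⟨p, .init, some x, []⟩)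
  /-- end of the init phase, some value has been received at least `n - 2t` times -/
  | initFrequent (s : LocalState n V) (v : V) : s.pc = .waitInit →
      n - t ≤ (s.received .init).length → n - 2 * t ≤ countVal v (s.received .init) →
      MainStep t p x s
        { s with est := v, estCert := s.received .init, pc := .newRound } 0
  /-- end of the init phase, no value has been received at least `n - 2t` times -/
  | initOwn (s : LocalState n V) : s.pc = .waitInit →
      n - t ≤ (s.received .init).length →
      (∀ w : V, countVal w (s.received .init) < n - 2 * t) →
      MainStep t p x s
        { s with
          est := x
          estCert := ⟨p, .init, some x, []⟩ :: s.received .init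
          pc := .newRound } 0
  /-- start of a round: send a query and set the timer of the coordinator -/
  | sendQuery (s : LocalState n V) (c : Fin n) : s.pc = .newRound → IsCoord (s.rd + 1) c →
      MainStep t p x s
        { s with rd := s.rd + 1, timer := some (s.delta c), pc := .waitResponse }
        (toAll ⟨p, .query (s.rd + 1), some s.est, s.estCert⟩)
  /-- end of the first phase, with a response from the coordinator -/
  | relayValue (s : LocalState n V) (c : Fin n) (m : Msg n V) : s.pc = .waitResponse →
      IsCoord s.rd c → m ∈ s.received (.response s.rd) → m.sender = c →
      MainStep t p x s
        { s with aux := m.val, delta := s.nextDelta c, timer := none, pc := .waitRelay }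
        (toAll ⟨p, .relay s.rd, m.val, [m]⟩)
  /-- end of the first phase, with a time-out, without a response from the coordinator -/
  | relayBot (s : LocalState n V) (c : Fin n) : s.pc = .waitResponse →
      IsCoord s.rd c → s.timer = some 0 →
      n - t ≤ (s.received (.response s.rd)).length →
      (∀ m ∈ s.received (.response s.rd), m.sender ≠ c) →
      MainStep t p x s
        { s with aux := none, delta := s.nextDelta c, timer := none, pc := .waitRelay }
        (toAll ⟨p, .relay s.rd, none, s.received (.response s.rd)⟩)
  /-- end of the second phase -/
  | sendFilt1 (s : LocalState n V) (a : Option V) : s.pc = .waitRelay →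
      n - t ≤ (s.received (.relay s.rd)).length →
      RelayRule (vals (s.received (.relay s.rd))) a →
      MainStep t p x s { s with aux := a, pc := .waitFilt1 }
        (toAll ⟨p, .filt1 s.rd, a, s.received (.relay s.rd)⟩)
  /-- end of the third phase -/
  | sendFilt2 (s : LocalState n V) (a : Option V) : s.pc = .waitFilt1 →
      n - t ≤ (s.received (.filt1 s.rd)).length →
      FiltRule (vals (s.received (.filt1 s.rd))) a →
      MainStep t p x s { s with aux := a, pc := .waitFilt2 }
        (toAll ⟨p, .filt2 s.rd, a, s.received (.filt1 s.rd)⟩)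
  /-- end of the fourth phase, only one value `v ≠ ⊥` received: decide `v` -/
  | decide (s : LocalState n V) (v : V) : s.pc = .waitFilt2 →
      n - t ≤ (s.received (.filt2 s.rd)).length →
      vals (s.received (.filt2 s.rd)) = {some v} →
      MainStep t p x s { s with decided := some v, pc := .done }
        (toAll ⟨p, .dec, some v, s.received (.filt2 s.rd)⟩)
  /-- end of the fourth phase, a value `v ≠ ⊥` and `⊥` received: adopt `v` -/
  | adopt (s : LocalState n V) (v : V) : s.pc = .waitFilt2 →
      n - t ≤ (s.received (.filt2 s.rd)).length →
      vals (s.received (.filt2 s.rd)) = {some v, none} →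
      MainStep t p x s
        { s with est := v, estCert := s.received (.filt2 s.rd), pc := .newRound } 0
  /-- end of the fourth phase, all other cases: keep the estimate -/
  | keep (s : LocalState n V) : s.pc = .waitFilt2 →
      n - t ≤ (s.received (.filt2 s.rd)).length →
      (∀ v : V, vals (s.received (.filt2 s.rd)) ≠ {some v} ∧
        vals (s.received (.filt2 s.rd)) ≠ {some v, none}) →
      MainStep t p x s
        { s with
          estCert := ⟨p, .query s.rd, some s.est, s.estCert⟩ :: s.received (.filt2 s.rd)
          pc := .newRound } 0
  /-- the local clock ticks while the timer is running -/
  | tick (s : LocalState n V) (k : ℕ) : s.timer = some (k + 1) →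
      MainStep t p x s { s with timer := some k } 0

/-- The daemon passes on a message that arrives on the link from `src` if the process has not yet
returned, the message is signed by `src`, it is valid, and it is not a duplicate: no message of
the same kind and round was accepted from `src` before. -/
def Accepts (t : ℕ) (s : LocalState n V) (src : Fin n) (m : Msg n V) : Prop :=
  s.pc ≠ .done ∧ m.sender = src ∧ Valid t m ∧
    ∀ m' ∈ s.rcvd, ¬ (m'.sender = src ∧ m'.tag = m.tag)

/-- Process `p` receives the message `m` on the link from `src`: new local state, and the messages
sent by the coordination tasks and by the decision task. -/
inductive ReceiveStep (t : ℕ) (p src : Fin n) (m : Msg n V) :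
    LocalState n V → LocalState n V → Out n V → Prop
  | discard (s : LocalState n V) : ¬ Accepts t s src m → ReceiveStep t p src m s s 0
  /-- messages that only the main task uses -/
  | store (s : LocalState n V) : Accepts t s src m →
      (∀ r, m.tag ≠ .query r) → m.tag ≠ .dec →
      ReceiveStep t p src m s { s with rcvd := m :: s.rcvd } 0
  /-- coordination task of round `r`: the coordinator receives the first query of the round -/
  | queryFirst (s : LocalState n V) (r : ℕ) : Accepts t s src m →
      m.tag = .query r → (IsCoord r p ∧ s.cEst r = none) →
      ReceiveStep t p src m s
        { s with
          rcvd := m :: s.rcvd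
          cEst := Function.update s.cEst r m.val
          cCert := Function.update s.cCert r [m] }
        {(src, ⟨p, .response r, m.val, [m]⟩)}
  /-- coordination task of round `r`: all other queries -/
  | queryOther (s : LocalState n V) (r : ℕ) : Accepts t s src m →
      m.tag = .query r → ¬ (IsCoord r p ∧ s.cEst r = none) →
      ReceiveStep t p src m s { s with rcvd := m :: s.rcvd }
        {(src, ⟨p, .response r, s.cEst r, s.cCert r⟩)}
  /-- decision task: relay the decision value with its certificate, and decide it -/
  | decide (s : LocalState n V) (v : V) : Accepts t s src m →
      m.tag = .dec → m.val = some v →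
      ReceiveStep t p src m s
        { s with rcvd := m :: s.rcvd, decided := some v, pc := .done }
        (toAll ⟨p, .dec, some v, m.cert⟩)

/-! ## The system -/

/-- Global state. -/
structure Config (n : ℕ) (V : Type u) : Type u where
  /-- local states (those of Byzantine processes play no role) -/
  loc : Fin n → LocalState n V
  /-- messages in transit: (source, destination, message) -/
  net : Multiset (Fin n × Fin n × Msg n V)
  /-- history: the messages that have been signed and sent by correct processes -/
  signed : Set (Msg n V)

/-- Initial global state: `input p` is the proposal of process `p`. -/
def Config.initial (input : Fin n → V) : Config n V where
  loc := fun p => .initial (input p)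
  net := 0
  signed := ∅

/-- The messages in `out`, put on the outgoing links of `p`. -/
def onLinks (p : Fin n) (out : Out n V) : Multiset (Fin n × Fin n × Msg n V) :=
  out.map (fun e => (p, e.1, e.2))

/-- The steps of the system, where `byz` is the set of Byzantine processes.  Links do not create,
alter or duplicate messages, and there is no bound on transfer delays or relative speeds.  A
Byzantine process can send anything to anybody, except that no one can forge the signature of a
correct process: whatever a message contains under such a signature was signed by that process. -/
inductive Step (t : ℕ) (byz : Finset (Fin n)) (input : Fin n → V) :
    Config n V → Config n V → Prop
  /-- a correct process performs a step of its main task -/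
  | main (c : Config n V) (p : Fin n) (s : LocalState n V) (out : Out n V) : p ∉ byz →
      MainStep t p (input p) (c.loc p) s out →
      Step t byz input c
        ⟨Function.update c.loc p s, c.net + onLinks p out, c.signed ∪ {m | ∃ q, (q, m) ∈ out}⟩
  /-- a correct process receives a message -/
  | receive (c : Config n V) (src p : Fin n) (m : Msg n V)
      (rest : Multiset (Fin n × Fin n × Msg n V)) (s : LocalState n V) (out : Out n V) :
      p ∉ byz → c.net = (src, p, m) ::ₘ rest → ReceiveStep t p src m (c.loc p) s out →
      Step t byz input c
        ⟨Function.update c.loc p s, rest + onLinks p out, c.signed ∪ {m | ∃ q, (q, m) ∈ out}⟩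
  /-- a Byzantine process sends a message -/
  | byzSend (c : Config n V) (b q : Fin n) (m : Msg n V) : b ∈ byz →
      (∀ x, Sub x m → x.sender ∉ byz → x ∈ c.signed) →
      Step t byz input c ⟨c.loc, (b, q, m) ::ₘ c.net, c.signed⟩
  /-- a Byzantine process receives a message -/
  | byzReceive (c : Config n V) (src b : Fin n) (m : Msg n V)
      (rest : Multiset (Fin n × Fin n × Msg n V)) : b ∈ byz →
      c.net = (src, b, m) ::ₘ rest →
      Step t byz input c ⟨c.loc, rest, c.signed⟩

/-- A run of the system: an infinite sequence of global states from the initial one, in which each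
state is followed by itself or by the result of one step.  No liveness, timing or winning-link
condition is imposed. -/
def IsRun (t : ℕ) (byz : Finset (Fin n)) (input : Fin n → V) (ρ : ℕ → Config n V) : Prop :=
  ρ 0 = Config.initial input ∧ ∀ k, ρ (k + 1) = ρ k ∨ Step t byz input (ρ k) (ρ (k + 1))

/-- In the run `ρ`, process `p` decides (returns) the value `v`: at the end of the fourth phase of
some round or on receipt of a DEC message. -/
def Decides (ρ : ℕ → Config n V) (p : Fin n) (v : V) : Prop :=
  ∃ k, ((ρ k).loc p).decided = some v

end AuthByzConsensus

/-!
The argument has a static and a dynamic half.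

Static half. Fix the set `S` of messages that the correct processes have signed, and suppose that no
correct process has signed two different FILT1 messages, or two different FILT2 messages, of the
same round (`SignsOnce`). Call a message *authentic* if everything inside it that bears a correct
signature lies in `S`. Two authentic quorums of the same kind and round have more than `t` senders
in common, hence a correct one, hence a common message (`exists_mem_both`). So all non-`⊥` values of
FILT2 messages of one round agree (`filt2_val_unique`), and if the FILT2 messages of some quorum of
round `r` all carry `v` (`Supports r v`, which is what a certified decision amounts to), then every
quorum of FILT2 messages of round `r` contains `v`. Hence each valid QUERY of round `r + 1` carries
`v`. In later rounds a non-`⊥` value of a valid message descends, through its certificate, from a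
valid QUERY of the same round (`exists_query_of_filt2`), so by induction on rounds every later
QUERY carries `v` (`query_val_of_supports`), and a decision in a later round is a decision for `v`
(`supports_agree`). Round `0` needs a remark: the certificates of QUERY messages of round `1` are
made of INIT messages, but no valid message belongs to round `0` (`round_pos`).

Dynamic half. The authenticity of all messages in transit, and of everything that the correct
processes store, is an invariant of the system (`LocalInv`, `step_inv`), as is `SignsOnce`:
a correct process signs a FILT1 or FILT2 message only at a point of its program that it has not
passed before in that round (`Passed`, `Discipline`). Two decisions made at different times are
compared in the later of the two configurations, since the set of signed messages only grows.
-/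

namespace AuthByzConsensus

/-! ### Authentic messages and quorums -/

section Static

variable {n t : ℕ} {V : Type u} {byz : Finset (Fin n)} {S S' : Set (Msg n V)}

theorem Sub.trans {x y z : Msg n V} (hxy : Sub x y) (hyz : Sub y z) : Sub x z := by
  induction hyz with
  | refl => exact hxy
  | cert m' m hm _ ih => exact .cert x m' m hm ih

theorem Sub.of_mem_cert {x m : Msg n V} (h : x ∈ m.cert) : Sub x m :=
  .cert x x m h (.refl x)

/-- Every message inside `m`, at any depth, that bears the signature of a correct process belongs
to `S`, the set of messages signed by correct processes so far. -/
def Authentic (byz : Finset (Fin n)) (S : Set (Msg n V)) (m : Msg n V) : Prop :=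
  ∀ x, Sub x m → x.sender ∉ byz → x ∈ S

theorem Authentic.mono {m : Msg n V} (h : Authentic byz S m) (hS : S ⊆ S') :
    Authentic byz S' m :=
  fun x hx hb => hS (h x hx hb)

theorem Authentic.sub {x m : Msg n V} (h : Authentic byz S m) (hx : Sub x m) :
    Authentic byz S x :=
  fun y hy => h y (hy.trans hx)

theorem Authentic.of_mem_cert {x m : Msg n V} (h : Authentic byz S m) (hx : x ∈ m.cert) :
    Authentic byz S x :=
  h.sub (.of_mem_cert hx)

theorem authentic_of_mem {m : Msg n V} (hm : m ∈ S) (hc : ∀ x ∈ m.cert, Authentic byz S x) :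
    Authentic byz S m := by
  intro x hx hb
  cases hx with
  | refl => exact hm
  | cert m' _ hm' hx => exact hc m' hm' x hx hb

/-- The messages of the third and fourth phases, the only ones whose uniqueness matters. -/
def IsFilt (g : Tag) : Prop := ∃ r, g = .filt1 r ∨ g = .filt2 r

/-- No correct process has signed two different FILT1 messages, or two different FILT2 messages, of
the same round. -/
def SignsOnce (byz : Finset (Fin n)) (S : Set (Msg n V)) : Prop :=
  ∀ m ∈ S, ∀ m' ∈ S, m.sender ∉ byz → m.sender = m'.sender → m.tag = m'.tag → IsFilt m.tag → m = m'

theorem IsQuorum.ne_nil {g : Tag} {F : List (Msg n V)} (hn : 3 * t < n) (h : IsQuorum t g F) :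
    ∃ m, m ∈ F := by
  apply List.exists_mem_of_length_pos
  have := h.2.2
  omega

/-- Quorum intersection: two quorums of authentic messages share a message of a correct process. -/
theorem exists_mem_both {g : Tag} {F F' : List (Msg n V)} (hn : 3 * t < n) (hbyz : byz.card ≤ t)
    (hS : SignsOnce byz S) (hg : IsFilt g) (hF : IsQuorum t g F) (hF' : IsQuorum t g F')
    (ha : ∀ m ∈ F, Authentic byz S m) (ha' : ∀ m ∈ F', Authentic byz S m) :
    ∃ m ∈ F, m ∈ F' := by
  obtain ⟨ht, hd, hl⟩ := hF
  obtain ⟨ht', hd', hl'⟩ := hF'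
  have hA : (F.map Msg.sender).toFinset.card = F.length := by
    rw [List.toFinset_card_of_nodup hd, List.length_map]
  have hB : (F'.map Msg.sender).toFinset.card = F'.length := by
    rw [List.toFinset_card_of_nodup hd', List.length_map]
  have hI := Finset.card_union_add_card_inter
    (F.map Msg.sender).toFinset (F'.map Msg.sender).toFinset
  have hU : ((F.map Msg.sender).toFinset ∪ (F'.map Msg.sender).toFinset).card ≤ n := by
    simpa using Finset.card_le_univ ((F.map Msg.sender).toFinset ∪ (F'.map Msg.sender).toFinset)
  obtain ⟨p, hp, hpb⟩ := Finset.exists_mem_notMem_of_card_lt_card (s := byz)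
    (t := (F.map Msg.sender).toFinset ∩ (F'.map Msg.sender).toFinset) (by omega)
  simp only [Finset.mem_inter, List.mem_toFinset, List.mem_map] at hp
  obtain ⟨⟨m, hm, rfl⟩, m', hm', hs⟩ := hp
  have := hS m (ha m hm m (.refl m) hpb) m' (ha' m' hm' m' (.refl m') (hs ▸ hpb)) hpb hs.symm
    ((ht m hm).trans (ht' m' hm').symm) (ht m hm ▸ hg)
  exact ⟨m, hm, this ▸ hm'⟩

/-! ### What validity says about the certificate -/

theorem Valid.filt2_cert {m : Msg n V} {r : ℕ} (h : Valid t m) (hm : m.tag = .filt2 r) :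
    IsQuorum t (.filt1 r) m.cert ∧ (∀ x ∈ m.cert, Valid t x) ∧ FiltRule (vals m.cert) m.val := by
  cases h <;> simp_all

theorem Valid.filt1_cert {m : Msg n V} {r : ℕ} (h : Valid t m) (hm : m.tag = .filt1 r) :
    IsQuorum t (.relay r) m.cert ∧ (∀ x ∈ m.cert, Valid t x) ∧ RelayRule (vals m.cert) m.val := by
  cases h <;> simp_all

theorem Valid.dec_cert {m : Msg n V} {v : V} (h : Valid t m) (hm : m.tag = .dec)
    (hv : m.val = some v) :
    ∃ r, IsQuorum t (.filt2 r) m.cert ∧ (∀ x ∈ m.cert, Valid t x) ∧ vals m.cert = {some v} := by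
  cases h <;> simp_all
  exact ⟨_, ‹_›⟩

theorem Valid.relay_cert {m : Msg n V} {r : ℕ} {v : V} (h : Valid t m) (hm : m.tag = .relay r)
    (hv : m.val = some v) :
    ∃ x ∈ m.cert, Valid t x ∧ x.tag = .response r ∧ IsCoord r x.sender ∧ x.val = some v := by
  cases h <;> simp_all

theorem Valid.response_cert {m : Msg n V} {r : ℕ} {v : V} (h : Valid t m)
    (hm : m.tag = .response r) (hc : IsCoord r m.sender) (hv : m.val = some v) :
    ∃ x ∈ m.cert, Valid t x ∧ x.tag = .query r ∧ x.val = some v := by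
  cases h <;> simp_all

/-- No valid message belongs to round `0`. -/
theorem Valid.round_pos {m : Msg n V} (hn : 3 * t < n) (h : Valid t m) :
    m.tag ≠ .query 0 ∧ m.tag ≠ .response 0 ∧ m.tag ≠ .relay 0 ∧ m.tag ≠ .filt1 0 ∧
      m.tag ≠ .filt2 0 := by
  have key {g g' : Tag} {F : List (Msg n V)} (hF : IsQuorum t g F)
      (hg : ∀ m ∈ F, m.tag ≠ g') : g ≠ g' := by
    obtain ⟨x, hx⟩ := hF.ne_nil hn
    exact hF.1 x hx ▸ hg x hx
  induction h with
  | init | queryFrequent | queryOwn | queryAdopt | queryKeep | dec => simp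
  | responseOther p r x hr => simp; omega
  | responseCoord p r v m _ hm _ _ ih => simp_all
  | relayValue p r v m hm _ _ _ ih => simp_all
  | relayBot p r F hF _ _ ih => simpa using key hF fun m hm => (ih m hm).2.1
  | filt1 p r a F hF _ _ ih => simpa using key hF fun m hm => (ih m hm).2.2.1
  | filt2 p r a F hF _ _ ih => simpa using key hF fun m hm => (ih m hm).2.2.2.1

/-- A non-`⊥` value in the fourth phase of a round is the value of a query of the same round. -/
theorem Valid.exists_query_of_filt2 {m : Msg n V} {r : ℕ} {v : V} (h : Valid t m)
    (hm : m.tag = .filt2 r) (hv : m.val = some v) :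
    ∃ x, Sub x m ∧ Valid t x ∧ x.tag = .query r ∧ x.val = some v := by
  obtain ⟨hq, hV, hR⟩ := h.filt2_cert hm
  have h1 : some v ∈ vals m.cert := by rw [(hR v).1 hv]; rfl
  obtain ⟨a, ha, hav⟩ := h1
  obtain ⟨hq', hV', hR'⟩ := (hV a ha).filt1_cert (hq.1 a ha)
  have h2 : some v ∈ vals a.cert \ {none} := by rw [(hR' v).1 hav]; rfl
  obtain ⟨⟨b, hb, hbv⟩, -⟩ := h2
  obtain ⟨c, hc, hcV, hct, hcc, hcv⟩ := (hV' b hb).relay_cert (hq'.1 b hb) hbv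
  obtain ⟨d, hd, hdV, hdt, hdv⟩ := hcV.response_cert hct hcc hcv
  exact ⟨d, (Sub.of_mem_cert hd).trans <| (Sub.of_mem_cert hc).trans <|
    (Sub.of_mem_cert hb).trans (.of_mem_cert ha), hdV, hdt, hdv⟩

/-! ### Decisions lock the queries of later rounds -/

/-- There are valid and authentic FILT2 messages of round `r` from at least `n - t` processes, all
with value `v`: the evidence on which every decision for `v` rests. -/
def Supports (t : ℕ) (byz : Finset (Fin n)) (S : Set (Msg n V)) (r : ℕ) (v : V) : Prop :=
  ∃ F : List (Msg n V), IsQuorum t (.filt2 r) F ∧ (∀ m ∈ F, Valid t m) ∧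
    (∀ m ∈ F, Authentic byz S m) ∧ vals F = {some v}

theorem Supports.mono {r : ℕ} {v : V} (h : Supports t byz S r v) (hS : S ⊆ S') :
    Supports t byz S' r v := by
  obtain ⟨F, hq, hV, ha, hv⟩ := h
  exact ⟨F, hq, hV, fun m hm => (ha m hm).mono hS, hv⟩

theorem Supports.exists_filt2 {r : ℕ} {v : V} (hn : 3 * t < n) (h : Supports t byz S r v) :
    ∃ m, Valid t m ∧ Authentic byz S m ∧ m.tag = .filt2 r ∧ m.val = some v := by
  obtain ⟨F, hq, hV, ha, hv⟩ := h
  obtain ⟨m, hm⟩ := hq.ne_nil hn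
  have hmv : m.val ∈ vals F := ⟨m, hm, rfl⟩
  rw [hv] at hmv
  exact ⟨m, hV m hm, ha m hm, hq.1 m hm, hmv⟩

theorem filt2_val_unique {m m' : Msg n V} {r : ℕ} {v w : V} (hn : 3 * t < n)
    (hbyz : byz.card ≤ t) (hS : SignsOnce byz S) (h : Valid t m) (h' : Valid t m')
    (ha : Authentic byz S m) (ha' : Authentic byz S m') (hm : m.tag = .filt2 r)
    (hm' : m'.tag = .filt2 r) (hv : m.val = some v) (hw : m'.val = some w) : v = w := by
  obtain ⟨hq, -, hR⟩ := h.filt2_cert hm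
  obtain ⟨hq', -, hR'⟩ := h'.filt2_cert hm'
  obtain ⟨x, hx, hx'⟩ := exists_mem_both hn hbyz hS ⟨r, .inl rfl⟩ hq hq'
    (fun _ => ha.of_mem_cert) (fun _ => ha'.of_mem_cert)
  have e : x.val ∈ vals m.cert := ⟨x, hx, rfl⟩
  have e' : x.val ∈ vals m'.cert := ⟨x, hx', rfl⟩
  rw [(hR v).1 hv] at e
  rw [(hR' w).1 hw] at e'
  exact Option.some_injective _ (e.symm.trans e')

/-- The certificate of a query of a round after the first: either the value occurs in a FILT2
message of the preceding round, or only `⊥` occurs there and the sender had the same value in the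
preceding round. -/
theorem Valid.query_succ_cert {m : Msg n V} {r : ℕ} (h : Valid t m) (hr : 1 ≤ r)
    (hm : m.tag = .query (r + 1)) :
    (∃ x ∈ m.cert, Valid t x ∧ x.tag = .filt2 r ∧ x.val = m.val ∧ ∃ v, m.val = some v) ∨
    ∃ F, (∀ x ∈ F, x ∈ m.cert) ∧ IsQuorum t (.filt2 r) F ∧ vals F = {none} ∧
      ∃ x ∈ m.cert, Valid t x ∧ x.tag = .query r ∧ x.val = m.val := by
  cases h with
  | init | responseCoord | responseOther | relayValue | relayBot | filt1 | filt2 | dec => simp at hm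
  | queryFrequent => simp at hm; omega
  | queryOwn => simp at hm; omega
  | queryAdopt p r' v F hq hV hF =>
    obtain rfl : r' = r := by simpa using hm
    have hx : some v ∈ vals F := by rw [hF]; simp
    obtain ⟨x, hx, hxv⟩ := hx
    exact .inl ⟨x, hx, hV x hx, hq.1 x hx, hxv, v, rfl⟩
  | queryKeep p r' v C F hq hV hF hQ =>
    obtain rfl : r' = r := by simpa using hm
    exact .inr ⟨F, fun x hx => List.mem_cons_of_mem _ hx, hq, hF, _, List.mem_cons_self, hQ, rfl,
      rfl⟩

theorem query_val_of_supports {r : ℕ} {v : V} (hn : 3 * t < n) (hbyz : byz.card ≤ t)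
    (hS : SignsOnce byz S) (hs : Supports t byz S r v) (k : ℕ) {m : Msg n V} (h : Valid t m)
    (ha : Authentic byz S m) (hm : m.tag = .query (r + 1 + k)) : m.val = some v := by
  obtain ⟨x₀, hx₀, hax₀, htx₀, hvx₀⟩ := hs.exists_filt2 hn
  have hr : 1 ≤ r := by
    by_contra hr
    obtain rfl : r = 0 := by omega
    exact (hx₀.round_pos hn).2.2.2.2 htx₀
  induction k generalizing m with
  | zero =>
    rcases h.query_succ_cert hr hm with ⟨x, hx, hxV, hxt, hxv, w, hw⟩ | ⟨F, hFm, hq, hF, -⟩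
    · rw [hw, filt2_val_unique hn hbyz hS hx₀ hxV hax₀ (ha.of_mem_cert hx) htx₀ hxt hvx₀
        (hxv.trans hw)]
    -- A quorum of `⊥` only is impossible, as it meets the quorum for `v`.
    · obtain ⟨G, hqG, -, haG, hG⟩ := hs
      obtain ⟨y, hyF, hyG⟩ := exists_mem_both hn hbyz hS ⟨r, .inr rfl⟩ hq hqG
        (fun x hx => ha.of_mem_cert (hFm x hx)) haG
      have e : y.val ∈ vals F := ⟨y, hyF, rfl⟩
      have e' : y.val ∈ vals G := ⟨y, hyG, rfl⟩
      rw [hF] at e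
      rw [hG] at e'
      cases e.symm.trans e'
  | succ k ih =>
    rcases h.query_succ_cert (r := r + 1 + k) (by omega) hm with ⟨x, hx, hxV, hxt, hxv, w, hw⟩ |
      ⟨-, -, -, -, x, hx, hxV, hxt, hxv⟩
    · obtain ⟨y, hy, hyV, hyt, hyv⟩ := hxV.exists_query_of_filt2 hxt (hxv.trans hw)
      rw [hw, ← hyv]
      exact ih hyV ((ha.of_mem_cert hx).sub hy) hyt
    · rw [← hxv]
      exact ih hxV (ha.of_mem_cert hx) hxt

theorem supports_agree {r r' : ℕ} {v w : V} (hn : 3 * t < n) (hbyz : byz.card ≤ t)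
    (hS : SignsOnce byz S) (hv : Supports t byz S r v) (hw : Supports t byz S r' w) : v = w := by
  wlog hle : r ≤ r' generalizing r r' v w
  · exact (this hw hv (by omega)).symm
  obtain ⟨x, hx, hxa, hxt, hxv⟩ := hv.exists_filt2 hn
  obtain ⟨y, hy, hya, hyt, hyv⟩ := hw.exists_filt2 hn
  rcases hle.eq_or_lt with rfl | hlt
  · exact filt2_val_unique hn hbyz hS hx hy hxa hya hxt hyt hxv hyv
  · obtain ⟨z, hz, hzV, hzt, hzv⟩ := hy.exists_query_of_filt2 hyt hyv
    obtain ⟨k, rfl⟩ := Nat.exists_eq_add_of_lt hlt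
    have := query_val_of_supports hn hbyz hS hv k hzV (hya.sub hz) (by rw [hzt, Nat.add_right_comm])
    exact Option.some_injective _ (this.symm.trans hzv)

end Static

/-! ### Correct processes sign a FILT message at most once per round -/

section Dynamic

variable {n t : ℕ} {V : Type u} {byz : Finset (Fin n)} {S S' : Set (Msg n V)}
  {p : Fin n} {x : V} {s s' : LocalState n V} {out : Out n V}

/-- The messages that a process signs when it sends `out`. -/
abbrev msgs (out : Out n V) : Set (Msg n V) := {m | ∃ q, (q, m) ∈ out}

@[simp]
theorem mem_msgs_toAll (a b : Msg n V) : (∃ q, (q, a) ∈ toAll b) ↔ a = b := by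
  have : Nonempty (Fin n) := ⟨a.sender⟩
  simp [toAll, eq_comm]

/-- In the local state `s`, the point of the program at which a message of kind `g` is signed has
been passed. This is only meaningful for the FILT messages, and set to `True` for all others. The
control point `newRound` belongs to the end of round `s.rd`, and `done` to the end of everything. -/
def Passed (s : LocalState n V) : Tag → Prop
  | .filt1 r => r < s.rd ∨ r = s.rd ∧
      (s.pc = .waitFilt1 ∨ s.pc = .waitFilt2 ∨ s.pc = .newRound ∨ s.pc = .done)
  | .filt2 r => r < s.rd ∨ r = s.rd ∧ (s.pc = .waitFilt2 ∨ s.pc = .newRound ∨ s.pc = .done)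
  | _ => True

/-- Process `p` in local state `s` has signed FILT messages only where its program tells it to, and
none of them twice. -/
structure Discipline (S : Set (Msg n V)) (p : Fin n) (s : LocalState n V) : Prop where
  passed : ∀ m ∈ S, m.sender = p → Passed s m.tag
  once : ∀ m ∈ S, ∀ m' ∈ S, m.sender = p → m'.sender = p → m.tag = m'.tag → IsFilt m.tag → m = m'

theorem MainStep.sender_eq (h : MainStep t p x s s' out) : ∀ m ∈ msgs out, m.sender = p := by
  cases h <;> simp

theorem ReceiveStep.sender_eq {src : Fin n} {m₀ : Msg n V} (h : ReceiveStep t p src m₀ s s' out) :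
    ∀ m ∈ msgs out, m.sender = p := by
  cases h <;> simp

theorem MainStep.passed_mono (h : MainStep t p x s s' out) {g : Tag} (hg : Passed s g) :
    Passed s' g := by
  cases h <;> cases g <;> simp_all [Passed] <;> omega

theorem ReceiveStep.passed_mono {src : Fin n} {m₀ : Msg n V}
    (h : ReceiveStep t p src m₀ s s' out) {g : Tag} (hg : Passed s g) : Passed s' g := by
  cases h <;> cases g <;> simp_all [Passed] <;> omega

theorem MainStep.passed_of_mem (h : MainStep t p x s s' out) :
    ∀ m ∈ msgs out, Passed s' m.tag := by
  cases h <;> simp [Passed]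

theorem MainStep.fresh (h : MainStep t p x s s' out) :
    ∀ m ∈ msgs out, IsFilt m.tag → ¬ Passed s m.tag ∧ ∀ m' ∈ msgs out, m' = m := by
  cases h <;> simp_all [Passed, IsFilt]

theorem ReceiveStep.not_isFilt {src : Fin n} {m₀ : Msg n V} (h : ReceiveStep t p src m₀ s s' out) :
    ∀ m ∈ msgs out, Passed s' m.tag ∧ ¬ IsFilt m.tag := by
  cases h <;> simp [Passed, IsFilt]

theorem Discipline.main (hd : Discipline S p s) (h : MainStep t p x s s' out) :
    Discipline (S ∪ msgs out) p s' where
  passed := by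
    rintro m (hm | hm) hp
    · exact h.passed_mono (hd.passed m hm hp)
    · exact h.passed_of_mem m hm
  once := by
    rintro m (hm | hm) m' (hm' | hm') hp hp' ht hf
    · exact hd.once m hm m' hm' hp hp' ht hf
    · exact absurd (ht ▸ hd.passed m hm hp) (h.fresh m' hm' (ht ▸ hf)).1
    · exact absurd (ht ▸ hd.passed m' hm' hp') (h.fresh m hm hf).1
    · exact ((h.fresh m hm hf).2 m' hm').symm

theorem Discipline.receive {src : Fin n} {m₀ : Msg n V} (hd : Discipline S p s)
    (h : ReceiveStep t p src m₀ s s' out) : Discipline (S ∪ msgs out) p s' where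
  passed := by
    rintro m (hm | hm) hp
    · exact h.passed_mono (hd.passed m hm hp)
    · exact (h.not_isFilt m hm).1
  once := by
    rintro m (hm | hm) m' (hm' | hm') hp hp' ht hf
    · exact hd.once m hm m' hm' hp hp' ht hf
    · exact absurd (ht ▸ hf) (h.not_isFilt m' hm').2
    · exact absurd hf (h.not_isFilt m hm).2
    · exact absurd hf (h.not_isFilt m hm).2

theorem Discipline.of_other (hd : Discipline S p s) {q : Fin n} (hq : p ≠ q)
    (ho : ∀ m ∈ msgs out, m.sender = q) : Discipline (S ∪ msgs out) p s := by
  have key : ∀ m ∈ S ∪ msgs out, m.sender = p → m ∈ S := by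
    rintro m (hm | hm) hp
    · exact hm
    · exact absurd (hp.symm.trans (ho m hm)) hq
  exact ⟨fun m hm hp => hd.passed m (key m hm hp) hp,
    fun m hm m' hm' hp hp' => hd.once m (key m hm hp) m' (key m' hm' hp') hp hp'⟩

/-! ### Everything that a correct process stores is authentic -/

/-- What holds of the local state `s` of a correct process `p` with proposal `x`, when `S` is the
set of messages signed by correct processes. All conditions are monotone in `S`. The conditions on
the process's own INIT and QUERY messages are those under which it may cite these messages in the
certificate of a later QUERY. -/
structure LocalInv (t : ℕ) (byz : Finset (Fin n)) (S : Set (Msg n V)) (p : Fin n) (x : V)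
    (s : LocalState n V) : Prop where
  authentic : ∀ m ∈ s.rcvd, Authentic byz S m
  valid : ∀ m ∈ s.rcvd, Valid t m
  distinct : s.rcvd.Pairwise fun m m' => ¬ (m'.sender = m.sender ∧ m'.tag = m.tag)
  init_signed : s.pc = .waitInit → ⟨p, .init, some x, []⟩ ∈ S
  query_signed : s.pc = .waitResponse ∨ s.pc = .waitRelay ∨ s.pc = .waitFilt1 ∨ s.pc = .waitFilt2 →
    ⟨p, .query s.rd, some s.est, s.estCert⟩ ∈ S
  estCert : ∀ m ∈ s.estCert, Authentic byz S m
  cCert : ∀ r, ∀ m ∈ s.cCert r, Authentic byz S m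
  decided : ∀ v, s.decided = some v → ∃ r, Supports t byz S r v

theorem LocalInv.mono (h : LocalInv t byz S p x s) (hS : S ⊆ S') : LocalInv t byz S' p x s where
  authentic m hm := (h.authentic m hm).mono hS
  valid := h.valid
  distinct := h.distinct
  init_signed hp := hS (h.init_signed hp)
  query_signed hp := hS (h.query_signed hp)
  estCert m hm := (h.estCert m hm).mono hS
  cCert r m hm := (h.cCert r m hm).mono hS
  decided v hv := (h.decided v hv).imp fun _ hr => hr.mono hS

theorem localInv_initial : LocalInv t byz S p x (.initial x) := by
  constructor <;> simp [LocalState.initial]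

theorem LocalState.mem_rcvd_of_mem_received {g : Tag} {m : Msg n V} (h : m ∈ s.received g) :
    m ∈ s.rcvd :=
  List.mem_of_mem_filter h

theorem LocalInv.authentic_received (h : LocalInv t byz S p x s) {g : Tag} {m : Msg n V}
    (hm : m ∈ s.received g) : Authentic byz S m :=
  h.authentic m (LocalState.mem_rcvd_of_mem_received hm)

theorem LocalInv.isQuorum (h : LocalInv t byz S p x s) {g : Tag}
    (hl : n - t ≤ (s.received g).length) : IsQuorum t g (s.received g) := by
  have htag : ∀ m ∈ s.received g, m.tag = g := by simp [LocalState.received]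
  refine ⟨htag, ?_, hl⟩
  rw [List.Nodup, List.pairwise_map]
  refine (h.distinct.filter _).imp_of_mem fun {a b} ha hb hab he => hab ⟨he.symm, ?_⟩
  exact (htag b hb).trans (htag a ha).symm

/-- A message may be signed when the messages of its certificate are authentic. -/
theorem authentic_of_msgs (ho : ∀ m ∈ msgs out, ∀ y ∈ m.cert, Authentic byz S y) :
    ∀ m ∈ msgs out, Authentic byz (S ∪ msgs out) m :=
  fun m hm => authentic_of_mem (.inr hm) fun y hy => (ho m hm y hy).mono Set.subset_union_left

theorem LocalInv.authentic_main (hI : LocalInv t byz S p x s) (h : MainStep t p x s s' out) :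
    ∀ m ∈ msgs out, Authentic byz (S ∪ msgs out) m := by
  apply authentic_of_msgs
  cases h with
  | initFrequent | initOwn | adopt | keep | tick => simp
  | sendInit => simp
  | sendQuery => simpa using hI.estCert
  | relayValue c m _ _ hm => simpa using hI.authentic_received hm
  | relayBot => simpa using fun m hm => hI.authentic_received hm
  | sendFilt1 => simpa using fun m hm => hI.authentic_received hm
  | sendFilt2 => simpa using fun m hm => hI.authentic_received hm
  | decide => simpa using fun m hm => hI.authentic_received hm

theorem LocalInv.main (hI : LocalInv t byz S p x s) (h : MainStep t p x s s' out) :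
    LocalInv t byz (S ∪ msgs out) p x s' := by
  have hM := hI.mono (S' := S ∪ msgs out) Set.subset_union_left
  have hA {g : Tag} : ∀ m ∈ s.received g, Authentic byz (S ∪ msgs out) m :=
    fun m hm => hM.authentic_received hm
  cases h with
  | sendInit hp =>
    exact { hM with init_signed := by simp, query_signed := by simp }
  | initFrequent v hp hl hv =>
    exact { hM with init_signed := by simp, query_signed := by simp, estCert := hA }
  | initOwn hp hl hv =>
    refine { hM with init_signed := by simp, query_signed := by simp, estCert := ?_ }
    exact List.forall_mem_cons.2 ⟨authentic_of_mem (hM.init_signed hp) (by simp), hA⟩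
  | sendQuery c hp hc =>
    exact { hM with init_signed := by simp, query_signed := by simp }
  | relayValue c m hp =>
    exact { hM with init_signed := by simp, query_signed := fun _ => hM.query_signed (by simp [hp]) }
  | relayBot c hp =>
    exact { hM with init_signed := by simp, query_signed := fun _ => hM.query_signed (by simp [hp]) }
  | sendFilt1 a hp =>
    exact { hM with init_signed := by simp, query_signed := fun _ => hM.query_signed (by simp [hp]) }
  | sendFilt2 a hp =>
    exact { hM with init_signed := by simp, query_signed := fun _ => hM.query_signed (by simp [hp]) }
  | decide v hp hl hv =>
    refine { hM with init_signed := by simp, query_signed := by simp, decided := ?_ }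
    intro w hw
    obtain rfl : v = w := by simpa using hw
    exact ⟨s.rd, _, hI.isQuorum hl,
      fun m hm => hI.valid m (LocalState.mem_rcvd_of_mem_received hm), hA, hv⟩
  | adopt v hp hl hv =>
    exact { hM with init_signed := by simp, query_signed := by simp, estCert := hA }
  | keep hp hl hv =>
    refine { hM with init_signed := by simp, query_signed := by simp, estCert := ?_ }
    exact List.forall_mem_cons.2
      ⟨authentic_of_mem (hM.query_signed (by simp [hp])) hM.estCert, hA⟩
  | tick k hk => exact { hM with }

section Receive

variable {src : Fin n} {m₀ : Msg n V}

theorem LocalInv.authentic_receive (hI : LocalInv t byz S p x s) (h₀ : Authentic byz S m₀)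
    (h : ReceiveStep t p src m₀ s s' out) :
    ∀ m ∈ msgs out, Authentic byz (S ∪ msgs out) m := by
  apply authentic_of_msgs
  cases h with
  | discard | store => simp
  | queryFirst => simpa using h₀
  | queryOther r => simpa using hI.cCert r
  | decide => simpa using fun m hm => h₀.of_mem_cert hm

/-- The effect of storing an accepted message. -/
theorem LocalInv.accept (hI : LocalInv t byz S p x s) (h₀ : Authentic byz S m₀)
    (ha : Accepts t s src m₀) : LocalInv t byz S p x { s with rcvd := m₀ :: s.rcvd } := by
  obtain ⟨-, rfl, hV, hnew⟩ := ha
  exact { hI with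
    authentic := List.forall_mem_cons.2 ⟨h₀, hI.authentic⟩
    valid := List.forall_mem_cons.2 ⟨hV, hI.valid⟩
    distinct := List.pairwise_cons.2 ⟨hnew, hI.distinct⟩ }

theorem LocalInv.receive (hI : LocalInv t byz S p x s) (h₀ : Authentic byz S m₀)
    (h : ReceiveStep t p src m₀ s s' out) : LocalInv t byz (S ∪ msgs out) p x s' := by
  refine LocalInv.mono ?_ Set.subset_union_left
  cases h with
  | discard => exact hI
  | store ha => exact hI.accept h₀ ha
  | queryFirst r ha =>
    refine { hI.accept h₀ ha with cCert := fun r' => ?_ }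
    by_cases hr : r' = r
    · subst hr
      simpa using h₀
    · simpa [Function.update_of_ne hr] using hI.cCert r'
  | queryOther r ha => exact hI.accept h₀ ha
  | decide v ha htag hv =>
    refine { hI.accept h₀ ha with init_signed := by simp, query_signed := by simp, decided := ?_ }
    intro w hw
    obtain rfl : v = w := by simpa using hw
    obtain ⟨r, hq, hV, hvals⟩ := ha.2.2.1.dec_cert htag hv
    exact ⟨r, _, hq, hV, fun m hm => h₀.of_mem_cert hm, hvals⟩

end Receive

/-! ### The invariant of the system -/

variable {input : Fin n → V} {c c' : Config n V}

/-- The invariant of the system: what is in transit is authentic, and every correct process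
satisfies the two local invariants. -/
structure Inv (t : ℕ) (byz : Finset (Fin n)) (input : Fin n → V) (c : Config n V) : Prop where
  net : ∀ e ∈ c.net, Authentic byz c.signed e.2.2
  loc : ∀ p ∉ byz, LocalInv t byz c.signed p (input p) (c.loc p)
  discipline : ∀ p ∉ byz, Discipline c.signed p (c.loc p)

theorem inv_initial : Inv t byz input (.initial input) where
  net := by simp [Config.initial]
  loc p _ := localInv_initial
  discipline p _ := ⟨by simp [Config.initial], by simp [Config.initial]⟩

theorem Inv.signsOnce (h : Inv t byz input c) : SignsOnce byz c.signed :=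
  fun m hm m' hm' hb hs => (h.discipline m.sender hb).once m hm m' hm' rfl hs.symm

/-- The common part of the two kinds of steps of a correct process `p`. -/
theorem Inv.update (hI : Inv t byz input c) (hp : p ∉ byz)
    {net : Multiset (Fin n × Fin n × Msg n V)} (hnet : ∀ e ∈ net, e ∈ c.net)
    (hs : ∀ m ∈ msgs out, m.sender = p)
    (ha : ∀ m ∈ msgs out, Authentic byz (c.signed ∪ msgs out) m)
    (hl : LocalInv t byz (c.signed ∪ msgs out) p (input p) s')
    (hd : Discipline (c.signed ∪ msgs out) p s') :
    Inv t byz input ⟨Function.update c.loc p s', net + onLinks p out, c.signed ∪ msgs out⟩ where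
  net e he := by
    rcases Multiset.mem_add.1 he with he | he
    · exact (hI.net e (hnet e he)).mono Set.subset_union_left
    · obtain ⟨⟨q, m⟩, hm, rfl⟩ := Multiset.mem_map.1 he
      exact ha m ⟨q, hm⟩
  loc q hq := by
    by_cases h : q = p
    · subst h
      simpa using hl
    · simpa [Function.update_of_ne h] using (hI.loc q hq).mono Set.subset_union_left
  discipline q hq := by
    by_cases h : q = p
    · subst h
      simpa using hd
    · simpa [Function.update_of_ne h] using (hI.discipline q hq).of_other h hs

theorem step_inv (hI : Inv t byz input c) (h : Step t byz input c c') : Inv t byz input c' := by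
  cases h with
  | main p s out hp h =>
    exact hI.update hp (fun _ he => he) h.sender_eq ((hI.loc p hp).authentic_main h)
      ((hI.loc p hp).main h) ((hI.discipline p hp).main h)
  | receive src p m rest s out hp hnet h =>
    have h₀ : Authentic byz c.signed m := hI.net (src, p, m) (by simp [hnet])
    exact hI.update hp (fun e he => by simp [hnet, he]) h.sender_eq
      ((hI.loc p hp).authentic_receive h₀ h) ((hI.loc p hp).receive h₀ h)
      ((hI.discipline p hp).receive h)
  | byzSend b q m hb hm =>
    exact { hI with net := Multiset.forall_mem_cons.2 ⟨hm, hI.net⟩ }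
  | byzReceive src b m rest hb hnet =>
    exact { hI with net := fun e he => hI.net e (by simp [hnet, he]) }

theorem Step.signed_subset (h : Step t byz input c c') : c.signed ⊆ c'.signed := by
  cases h with
  | main | receive => exact Set.subset_union_left
  | byzSend | byzReceive => exact subset_rfl

variable {ρ : ℕ → Config n V}

theorem IsRun.inv (h : IsRun t byz input ρ) (k : ℕ) : Inv t byz input (ρ k) := by
  induction k with
  | zero => exact h.1 ▸ inv_initial
  | succ k ih =>
    rcases h.2 k with e | hs
    · exact e ▸ ih
    · exact step_inv ih hs

theorem IsRun.signed_mono (h : IsRun t byz input ρ) : Monotone fun k => (ρ k).signed := by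
  refine monotone_nat_of_le_succ fun k => ?_
  rcases h.2 k with e | hs
  · rw [e]
  · exact hs.signed_subset

end Dynamic

end AuthByzConsensus

theorem theorem1 {V : Type u} (n t : ℕ) (hn : 3 * t < n)
    (byz : Finset (Fin n)) (hbyz : byz.card ≤ t) (input : Fin n → V)
    (ρ : ℕ → AuthByzConsensus.Config n V) (hρ : AuthByzConsensus.IsRun t byz input ρ)
    (p q : Fin n) (hp : p ∉ byz) (hq : q ∉ byz) (v w : V)
    (hv : AuthByzConsensus.Decides ρ p v) (hw : AuthByzConsensus.Decides ρ q w) :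
    v = w := by
  obtain ⟨k, hk⟩ := hv
  obtain ⟨l, hl⟩ := hw
  obtain ⟨r, hr⟩ := ((hρ.inv k).loc p hp).decided v hk
  obtain ⟨r', hr'⟩ := ((hρ.inv l).loc q hq).decided w hl
  exact AuthByzConsensus.supports_agree hn hbyz (hρ.inv (max k l)).signsOnce
    (hr.mono (hρ.signed_mono (le_max_left k l))) (hr'.mono (hρ.signed_mono (le_max_right k l)))
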